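/- A normalized trace on a unital $C^*$-algebra $A$ is a positive linear functional $\tau$ on $A$ with $\tau(1)=1$ and $\tau(ab)=\tau(ba)$ for all $a,b\in A$. If $A$ is a simple unital $C^*$-algebra with a unique normalized trace $\tau$, its fundamental group is $$\mathcal{F}(A)=\{\tau\otimes \mathrm{Tr}(p)\in\mathbb{R}_+^\times \mid p \text{ is a projection in } M_n(A) \text{ for some } n \text{ such that } pM_n(A)p\cong A\},$$ where $\mathrm{Tr}$ is the unnormalized trace, so that $\tau\otimes\mathrm{Tr}(p)=\sum_{i=1}^n\tau(p_{ii})$, and $\cong$ means $*$-isomorphism of $C^*$-algebras. An $A$-$B$-equivalence bimodule is a complex $A$-$B$-bimodule $\mathcal{E}$ that is simultaneously a full left Hilbert $A$-module, with inner product ${}_A\langle\cdot,\cdot\rangle$, and a full right Hilbert $B$-module, with inner product $\langle\cdot,\cdot\rangle_B$, such that ${}_A\langle\xi,\eta\rangle\zeta=\xi\langle\eta,\zeta\rangle_B$ for all $\xi,\eta,\zeta\in\mathcal{E}$; $A$ is Morita equivalent to $B$ if such a bimodule exists. **Proposition.** Let $A$ and $B$ be simple unital $C^*$-algebras, each with a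 unique normalized trace. If $A$ is Morita equivalent to $B$, then $\mathcal{F}(A)=\mathcal{F}(B)$. -/

import Mathlib

open scoped ComplexOrder

universe u v w

/-- A unital C⋆-algebra is simple when it is nonzero and its only closed two-sided ideals are
`0` and the whole algebra. -/
structure IsSimpleCStarAlgebra (A : Type u) [CStarAlgebra A] : Prop where
  nontrivial : Nontrivial A
  eq_bot_or_eq_top : ∀ I : TwoSidedIdeal A, IsClosed (I : Set A) → I = ⊥ ∨ I = ⊤

/-- A normalized trace (tracial state): a positive linear functional with `τ 1 = 1` and
`τ (a b) = τ (b a)`. -/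
structure IsNormalizedTrace {A : Type u} [CStarAlgebra A] (τ : A →ₗ[ℂ] ℂ) : Prop where
  nonneg : ∀ a : A, 0 ≤ τ (star a * a)
  map_one : τ 1 = 1
  map_mul_comm : ∀ a b : A, τ (a * b) = τ (b * a)

/-- `A` has exactly one normalized trace. -/
def HasUniqueTrace (A : Type u) [CStarAlgebra A] : Prop :=
  ∃! τ : A →ₗ[ℂ] ℂ, IsNormalizedTrace τ

/-- The unique normalized trace of `A`. -/
noncomputable def HasUniqueTrace.trace {A : Type u} [CStarAlgebra A] (h : HasUniqueTrace A) :
    A →ₗ[ℂ] ℂ :=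
  h.choose

/-- The functional `τ ⊗ Tr` on `Mₙ(A)`, where `Tr` is the unnormalized trace. -/
noncomputable def tensorTr {A : Type u} [CStarAlgebra A] (τ : A →ₗ[ℂ] ℂ) {n : ℕ}
    (p : Matrix (Fin n) (Fin n) A) : ℂ :=
  ∑ i, τ (p i i)

/-- The corner `p Mₙ(A) p` of a projection `p`, as a star-subalgebra (not sharing the unit)
of `Mₙ(A)`; the involution of `Mₙ(A)` is the conjugate transpose. -/
def matrixCorner {A : Type u} [CStarAlgebra A] {n : ℕ} (p : Matrix (Fin n) (Fin n) A)
    (hp : IsStarProjection p) : NonUnitalStarSubalgebra ℂ (Matrix (Fin n) (Fin n) A) where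
  carrier := {x | ∃ y, x = p * y * p}
  zero_mem' := ⟨0, by simp⟩
  add_mem' := by
    rintro _ _ ⟨y, rfl⟩ ⟨z, rfl⟩
    exact ⟨y + z, by simp [mul_add, add_mul]⟩
  mul_mem' := by
    rintro _ _ ⟨y, rfl⟩ ⟨z, rfl⟩
    exact ⟨y * p * p * z, by simp only [mul_assoc]⟩
  smul_mem' := by
    rintro c _ ⟨y, rfl⟩
    exact ⟨c • y, by simp⟩
  star_mem' := by
    rintro _ ⟨y, rfl⟩
    exact ⟨star y, by simp only [star_mul, hp.isSelfAdjoint.star_eq, mul_assoc]⟩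

/-- The fundamental group of a C⋆-algebra with unique normalized trace `τ`: the set of positive
reals `(τ ⊗ Tr)(p)`, where `p` runs over the projections of the matrix algebras `Mₙ(A)` such that
`p Mₙ(A) p` is star-isomorphic to `A`. -/
def fundamentalGroup (A : Type u) [CStarAlgebra A] (h : HasUniqueTrace A) : Set ℝ :=
  {t | 0 < t ∧ ∃ (n : ℕ) (p : Matrix (Fin n) (Fin n) A) (hp : IsStarProjection p),
    Nonempty (matrixCorner p hp ≃⋆ₐ[ℂ] A) ∧ tensorTr h.trace p = (t : ℂ)}

/-- Completeness of an additive group with respect to a norm `N`: every Cauchy sequence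
converges. -/
def IsCompleteForNorm {E : Type w} [AddCommGroup E] (N : E → ℝ) : Prop :=
  ∀ x : ℕ → E, (∀ ε > 0, ∃ k, ∀ m ≥ k, ∀ n ≥ k, N (x m - x n) < ε) →
    ∃ y : E, ∀ ε > 0, ∃ k, ∀ n ≥ k, N (x n - y) < ε

/-- The structure of a full left Hilbert `A`-module on a left `A`-module `E`: an `A`-valued inner
product, linear in the first variable, for whose norm `‖⟨x, x⟩‖ ^ (1/2)` the module is complete.
Mathlib's `CStarModule` is tied to one given norm on `E`, whereas the bimodules below carry two
inner products and, a priori, two norms. -/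
structure FullLeftHilbertModule (A : Type u) (E : Type w) [CStarAlgebra A] [AddCommGroup E]
    [Module A E] where
  inner : E → E → A
  inner_add_left : ∀ x y z, inner (x + y) z = inner x z + inner y z
  inner_smul_left : ∀ (a : A) x y, inner (a • x) y = a * inner x y
  star_inner : ∀ x y, star (inner x y) = inner y x
  inner_self_nonneg : ∀ x, ∃ a : A, inner x x = star a * a
  inner_self_eq_zero : ∀ x, inner x x = 0 → x = 0
  complete : IsCompleteForNorm fun x : E => √‖inner x x‖
  full : Dense (Submodule.span ℂ {a : A | ∃ x y, a = inner x y} : Set A)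

/-- The structure of a full right Hilbert `B`-module on a right `B`-module `E` (that is, a left
module over `Bᵐᵒᵖ`; `MulOpposite.op b • x` is `x b`): a `B`-valued inner product, linear in the
second variable, for whose norm `‖⟨x, x⟩‖ ^ (1/2)` the module is complete. -/
structure FullRightHilbertModule (B : Type v) (E : Type w) [CStarAlgebra B] [AddCommGroup E]
    [Module Bᵐᵒᵖ E] where
  inner : E → E → B
  inner_add_right : ∀ x y z, inner x (y + z) = inner x y + inner x z
  inner_smul_right : ∀ x y (b : B), inner x (MulOpposite.op b • y) = inner x y * b
  star_inner : ∀ x y, star (inner x y) = inner y x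
  inner_self_nonneg : ∀ x, ∃ b : B, inner x x = star b * b
  inner_self_eq_zero : ∀ x, inner x x = 0 → x = 0
  complete : IsCompleteForNorm fun x : E => √‖inner x x‖
  full : Dense (Submodule.span ℂ {b : B | ∃ x y, b = inner x y} : Set B)

/-- The structure of an `A`-`B`-equivalence bimodule on a complex `A`-`B`-bimodule `E`: a full
left Hilbert `A`-module structure and a full right Hilbert `B`-module structure with
`_A⟨x, y⟩ z = x ⟨y, z⟩_B`. -/
structure EquivalenceBimodule (A : Type u) (B : Type v) (E : Type w) [CStarAlgebra A]
    [CStarAlgebra B] [AddCommGroup E] [Module ℂ E] [Module A E] [Module Bᵐᵒᵖ E]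
    [IsScalarTower ℂ A E] [IsScalarTower ℂ Bᵐᵒᵖ E] [SMulCommClass A Bᵐᵒᵖ E] where
  left : FullLeftHilbertModule A E
  right : FullRightHilbertModule B E
  left_smul_eq : ∀ x y z, left.inner x y • z = MulOpposite.op (right.inner y z) • x

/-- `A` is Morita equivalent to `B` when there is an `A`-`B`-equivalence bimodule (in the
universe `w`, which is arbitrary). -/
def MoritaEquivalent (A : Type u) (B : Type v) [CStarAlgebra A] [CStarAlgebra B] : Prop :=
  ∃ (E : Type w) (_ : AddCommGroup E) (_ : Module ℂ E) (_ : Module A E) (_ : Module Bᵐᵒᵖ E)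
    (_ : IsScalarTower ℂ A E) (_ : IsScalarTower ℂ Bᵐᵒᵖ E) (_ : SMulCommClass A Bᵐᵒᵖ E),
    Nonempty (EquivalenceBimodule A B E)

/-! An equivalence bimodule has finite tight frames on both sides, and the Gram matrices `⟨uᵢ, a
uⱼ⟩_B` and `_A⟨vᵢ b, vⱼ⟩` identify `A` with a corner of matrices over `B` and conversely (`leftHom`,
`rightHom`). Uniqueness of the trace forces every star homomorphism `A → Mₙ(B)` to scale traces by a
constant (`map_trace_starAlgHom`), and the constants of these two embeddings are mutually inverse
(`trace_leftHom_mul_trace_rightHom`). If `ψ` embeds `A` as a corner over itself with trace `t`,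
conjugating it by the two embeddings gives a corner embedding of `B` over itself, again of trace
`t`. -/

/-- A star homomorphism of a unital algebra into a matrix algebra which is an isomorphism onto
the corner cut out by the image of the unit. -/
structure IsCornerEmbedding {R S ι : Type*} [Ring R] [StarRing R] [Algebra ℂ R] [Ring S]
    [StarRing S] [Algebra ℂ S] [Fintype ι] (φ : R →⋆ₙₐ[ℂ] Matrix ι ι S) : Prop where
  injective : Function.Injective φ
  exists_eq : ∀ y, ∃ a, φ a = φ 1 * y * φ 1

/-! ### Corner embeddings: amplification, composition, reindexing. -/

section Corner

variable {R S T ι κ : Type*} [Ring R] [StarRing R] [Algebra ℂ R] [Ring S]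
  [StarRing S] [Algebra ℂ S] [Ring T] [StarRing T] [Algebra ℂ T]
  [Fintype ι] [Fintype κ]

/-- The entrywise extension of a star homomorphism `R → M_ι(S)` to matrices over `R`. -/
def amplify (κ : Type*) [Fintype κ] (φ : R →⋆ₙₐ[ℂ] Matrix ι ι S) :
    Matrix κ κ R →⋆ₙₐ[ℂ] Matrix (κ × ι) (κ × ι) S where
  toFun M := Matrix.of fun i j => φ (M i.1 j.1) i.2 j.2
  map_smul' c M := by ext i j; simp
  map_zero' := by ext i j; simp
  map_add' M N := by ext i j; simp
  map_mul' M N := by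
    ext i j
    simp [Matrix.mul_apply, map_sum, Matrix.sum_apply, Fintype.sum_prod_type]
  map_star' M := by
    ext i j
    simp [Matrix.star_apply, map_star]

theorem amplify_apply (φ : R →⋆ₙₐ[ℂ] Matrix ι ι S) (M : Matrix κ κ R) (i j : κ × ι) :
    amplify κ φ M i j = φ (M i.1 j.1) i.2 j.2 := rfl

theorem trace_amplify (φ : R →⋆ₙₐ[ℂ] Matrix ι ι S) (M : Matrix κ κ R) :
    (amplify κ φ M).trace = ∑ i, (φ (M i i)).trace := by
  simp [Matrix.trace, Fintype.sum_prod_type, amplify_apply]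

theorem amplify_one_apply [DecidableEq κ] (φ : R →⋆ₙₐ[ℂ] Matrix ι ι S) (i j : κ × ι) :
    amplify κ φ 1 i j = if i.1 = j.1 then φ 1 i.2 j.2 else 0 := by
  rw [amplify_apply, Matrix.one_apply]
  split_ifs <;> simp

theorem IsCornerEmbedding.amplify [DecidableEq κ] {φ : R →⋆ₙₐ[ℂ] Matrix ι ι S}
    (h : IsCornerEmbedding φ) : IsCornerEmbedding (amplify κ φ) where
  injective M N hMN := by
    ext i j
    apply h.injective
    ext a b
    exact congr_fun₂ hMN (i, a) (j, b)
  exists_eq y := by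
    -- The image of the unit is block diagonal with blocks `φ 1`, so compression acts on each block
    -- separately.
    choose a ha using fun i j : κ => h.exists_eq (Matrix.of fun s t => y (i, s) (j, t))
    refine ⟨Matrix.of a, ?_⟩
    ext i j
    rw [amplify_apply, Matrix.of_apply, ha]
    simp [Matrix.mul_apply, amplify_one_apply, Fintype.sum_prod_type, ite_mul, mul_ite,
      Finset.sum_ite_eq, Finset.sum_mul]

theorem IsCornerEmbedding.comp [DecidableEq κ] {φ : R →⋆ₙₐ[ℂ] Matrix κ κ S}
    {ψ : Matrix κ κ S →⋆ₙₐ[ℂ] Matrix ι ι T} (hψ : IsCornerEmbedding ψ)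
    (hφ : IsCornerEmbedding φ) : IsCornerEmbedding (ψ.comp φ) where
  injective := hψ.injective.comp hφ.injective
  exists_eq y := by
    obtain ⟨x, hx⟩ := hψ.exists_eq y
    obtain ⟨a, ha⟩ := hφ.exists_eq x
    refine ⟨a, ?_⟩
    -- The projection `ψ (φ 1)` lies below `ψ 1`, so `y` may be compressed by `ψ 1` first and pulled
    -- back through `ψ`.
    have h1 : ψ (φ 1) = ψ (φ 1) * ψ 1 := by rw [← map_mul, mul_one]
    have h2 : ψ (φ 1) = ψ 1 * ψ (φ 1) := by rw [← map_mul, one_mul]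
    simp only [NonUnitalStarAlgHom.comp_apply]
    rw [ha, map_mul, map_mul, hx]
    conv_rhs => rw [h1]
    conv_rhs => enter [2]; rw [← h1, h2]
    simp only [mul_assoc]

/-- Reindexing of matrices as a star homomorphism. -/
def reindexStar (e : ι ≃ κ) : Matrix ι ι S →⋆ₙₐ[ℂ] Matrix κ κ S where
  toFun M := M.submatrix e.symm e.symm
  map_smul' _ _ := rfl
  map_zero' := rfl
  map_add' _ _ := rfl
  map_mul' M N := (Matrix.submatrix_mul_equiv M N e.symm e.symm e.symm).symm
  map_star' _ := rfl

theorem reindexStar_apply (e : ι ≃ κ) (M : Matrix ι ι S) (i j : κ) :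
    reindexStar e M i j = M (e.symm i) (e.symm j) := rfl

theorem isCornerEmbedding_reindexStar [DecidableEq ι] (e : ι ≃ κ) :
    IsCornerEmbedding (reindexStar (S := S) e) where
  injective M N h := by
    ext i j
    simpa [reindexStar_apply] using congr_fun₂ h (e i) (e j)
  exists_eq y := by
    classical
    refine ⟨y.submatrix e e, ?_⟩
    have h1 : reindexStar (S := S) e 1 = 1 := Matrix.submatrix_one_equiv e.symm
    rw [h1, one_mul, mul_one]
    ext i j
    simp [reindexStar_apply]

end Corner

/-! ### Scaling of traces, and the fundamental group via corner embeddings. -/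

section FundamentalGroup

variable {A : Type u} {B : Type v} [CStarAlgebra A] [CStarAlgebra B]

theorem HasUniqueTrace.isNormalizedTrace_trace (h : HasUniqueTrace A) :
    IsNormalizedTrace h.trace :=
  h.choose_spec.1

theorem tensorTr_eq_trace (τ : A →ₗ[ℂ] ℂ) {n : ℕ} (p : Matrix (Fin n) (Fin n) A) :
    tensorTr τ p = τ p.trace := by
  simp [tensorTr, Matrix.trace]

/-- A positive tracial functional on an algebra with a unique normalized trace is a multiple of
that trace. -/
theorem HasUniqueTrace.eq_smul_trace (h : HasUniqueTrace A) (f : A →ₗ[ℂ] ℂ)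
    (hf : ∀ a, 0 ≤ f (star a * a)) (hcomm : ∀ a b, f (a * b) = f (b * a)) (a : A) :
    f a = f 1 * h.trace a := by
  have hτ := h.isNormalizedTrace_trace
  have h1 : 0 ≤ f 1 := by simpa using hf 1
  have hne : 1 + f 1 ≠ 0 := (add_pos_of_pos_of_nonneg one_pos h1).ne'
  have hinv : 0 ≤ (1 + f 1)⁻¹ := inv_nonneg.mpr (add_nonneg zero_le_one h1)
  -- Normalizing `τ + f` instead of `f` avoids a separate case `f 1 = 0`.
  have key : IsNormalizedTrace ((1 + f 1)⁻¹ • (h.trace + f)) :=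
    { nonneg := fun a => mul_nonneg hinv (add_nonneg (hτ.nonneg a) (hf a))
      map_one := by
        rw [LinearMap.smul_apply, LinearMap.add_apply, hτ.map_one, smul_eq_mul, inv_mul_cancel₀ hne]
      map_mul_comm := fun a b => by simp [hτ.map_mul_comm a b, hcomm a b] }
  have h2 := congr_arg (fun g => g a) (h.unique key hτ)
  simp only [LinearMap.smul_apply, LinearMap.add_apply, smul_eq_mul] at h2
  rw [inv_mul_eq_iff_eq_mul₀ hne] at h2
  linear_combination h2

theorem IsNormalizedTrace.map_trace_star_mul_self_nonneg {ι : Type*} [Fintype ι]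
    {τ : B →ₗ[ℂ] ℂ} (hτ : IsNormalizedTrace τ) (M : Matrix ι ι B) :
    0 ≤ τ (star M * M).trace := by
  simp only [Matrix.trace, Matrix.diag_apply, Matrix.mul_apply, Matrix.star_apply, map_sum]
  exact Finset.sum_nonneg fun i _ => Finset.sum_nonneg fun j _ => hτ.nonneg _

theorem IsNormalizedTrace.map_trace_mul_comm {ι : Type*} [Fintype ι]
    {τ : B →ₗ[ℂ] ℂ} (hτ : IsNormalizedTrace τ) (M N : Matrix ι ι B) :
    τ (M * N).trace = τ (N * M).trace := by
  simp only [Matrix.trace, Matrix.diag_apply, Matrix.mul_apply, map_sum]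
  rw [Finset.sum_comm]
  exact Finset.sum_congr rfl fun i _ => Finset.sum_congr rfl fun j _ => hτ.map_mul_comm _ _

theorem HasUniqueTrace.map_trace_starAlgHom (hA : HasUniqueTrace A) (hB : HasUniqueTrace B)
    {ι : Type*} [Fintype ι] (φ : A →⋆ₙₐ[ℂ] Matrix ι ι B) (a : A) :
    hB.trace (φ a).trace = hB.trace (φ 1).trace * hA.trace a := by
  have hτ := hB.isNormalizedTrace_trace
  let f : A →ₗ[ℂ] ℂ :=
    { toFun := fun a => hB.trace (φ a).trace
      map_add' := fun a b => by simp
      map_smul' := fun c a => by simp [Matrix.trace_smul] }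
  refine hA.eq_smul_trace f (fun a => ?_) (fun a b => ?_) a
  · simpa [f, map_mul, map_star] using hτ.map_trace_star_mul_self_nonneg (φ a)
  · simpa [f, map_mul] using hτ.map_trace_mul_comm (φ a) (φ b)

theorem HasUniqueTrace.map_trace_amplify (hA : HasUniqueTrace A) (hB : HasUniqueTrace B)
    {ι κ : Type*} [Fintype ι] [Fintype κ] (φ : A →⋆ₙₐ[ℂ] Matrix ι ι B) (M : Matrix κ κ A) :
    hB.trace (amplify κ φ M).trace = hB.trace (φ 1).trace * hA.trace M.trace := by
  rw [trace_amplify, map_sum, Finset.sum_congr rfl fun i _ => hA.map_trace_starAlgHom hB φ _,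
    ← Finset.mul_sum, ← map_sum]
  rfl

theorem exists_isCornerEmbedding_of_mem_fundamentalGroup {h : HasUniqueTrace A} {t : ℝ}
    (ht : t ∈ fundamentalGroup A h) :
    ∃ (n : ℕ) (φ : A →⋆ₙₐ[ℂ] Matrix (Fin n) (Fin n) A), IsCornerEmbedding φ ∧
      h.trace (φ 1).trace = t := by
  obtain ⟨-, n, p, hp, ⟨e⟩, ht⟩ := ht
  let φ : A →⋆ₙₐ[ℂ] Matrix (Fin n) (Fin n) A :=
    { toFun := fun a => (e.symm a : Matrix (Fin n) (Fin n) A)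
      map_smul' := fun c a => by simp
      map_zero' := by simp
      map_add' := fun a b => by simp
      map_mul' := fun a b => by simp
      map_star' := fun a => by simp [map_star] }
  have hφ (a : A) : φ a = (e.symm a : Matrix (Fin n) (Fin n) A) := rfl
  have hpp : p * p = p := hp.isIdempotentElem
  -- Both are units of the corner: `p` is in the range of `φ`, and `φ 1` has the form `p * y * p`.
  have h1 : φ 1 = p := by
    have hm : p ∈ matrixCorner p hp := ⟨p, by rw [hpp, hpp]⟩
    have h2 : φ 1 * p = p := by
      have : φ (e ⟨p, hm⟩) = p := by simp [hφ]
      rw [← this, ← map_mul, one_mul]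
    obtain ⟨y, hy⟩ := (e.symm 1).2
    rw [← hφ] at hy
    rw [← h2, hy, mul_assoc, mul_assoc, mul_assoc, hpp]
  refine ⟨n, φ, ⟨fun a b hab => e.symm.injective (Subtype.ext hab), fun y => ?_⟩, ?_⟩
  · exact ⟨e ⟨p * y * p, y, rfl⟩, by rw [h1, hφ, e.symm_apply_apply]⟩
  · rw [h1, ← tensorTr_eq_trace, ht]

theorem mem_fundamentalGroup_of_isCornerEmbedding {h : HasUniqueTrace A} {t : ℝ} (ht : 0 < t)
    {ι : Type*} [Fintype ι] [DecidableEq ι] {φ : A →⋆ₙₐ[ℂ] Matrix ι ι A}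
    (hφ : IsCornerEmbedding φ) (htr : h.trace (φ 1).trace = t) : t ∈ fundamentalGroup A h := by
  let r := Fintype.equivFin ι
  let ψ := (reindexStar r).comp φ
  have hψ : IsCornerEmbedding ψ := (isCornerEmbedding_reindexStar r).comp hφ
  have hp : IsStarProjection (ψ 1) :=
    ⟨by rw [IsIdempotentElem, ← map_mul, one_mul], by rw [IsSelfAdjoint, ← map_star, star_one]⟩
  have hmem (a : A) : ψ a ∈ matrixCorner (ψ 1) hp :=
    ⟨ψ a, by rw [← map_mul, ← map_mul, one_mul, mul_one]⟩
  refine ⟨ht, _, ψ 1, hp, ⟨(StarAlgEquiv.ofBijective (NonUnitalStarAlgHom.codRestrict ψ _ hmem) ⟨?_, ?_⟩).symm⟩, ?_⟩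
  · intro a b hab
    exact hψ.injective (congr_arg Subtype.val hab)
  · rintro ⟨_, y, rfl⟩
    obtain ⟨a, ha⟩ := hψ.exists_eq y
    exact ⟨a, Subtype.ext ha⟩
  · rw [tensorTr_eq_trace, ← htr]
    congr 1
    exact Equiv.sum_comp r.symm fun i => φ 1 i i

/-- Corner embeddings in both directions with mutually inverse traces transport elements of the
fundamental group. -/
theorem fundamentalGroup_subset (hA : HasUniqueTrace A) (hB : HasUniqueTrace B) {k l : ℕ}
    {θ : A →⋆ₙₐ[ℂ] Matrix (Fin k) (Fin k) B} {ρ : B →⋆ₙₐ[ℂ] Matrix (Fin l) (Fin l) A}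
    (hθ : IsCornerEmbedding θ) (hρ : IsCornerEmbedding ρ)
    (hθρ : hB.trace (θ 1).trace * hA.trace (ρ 1).trace = 1) :
    fundamentalGroup A hA ⊆ fundamentalGroup B hB := by
  intro t ht
  obtain ⟨n, ψ, hψ, hψt⟩ := exists_isCornerEmbedding_of_mem_fundamentalGroup ht
  refine mem_fundamentalGroup_of_isCornerEmbedding ht.1
    (hθ.amplify.comp (hψ.amplify.comp hρ)) ?_
  rw [NonUnitalStarAlgHom.comp_apply, NonUnitalStarAlgHom.comp_apply, 
    hA.map_trace_amplify hB, hA.map_trace_amplify hA, hψt]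
  linear_combination (t : ℂ) * hθρ

end FundamentalGroup

/-! ### Existence of finite tight frames. -/

section Frame

attribute [local instance] CStarAlgebra.spectralOrder CStarAlgebra.spectralOrderedRing

/-- A full module with an algebra-valued inner product over a unital algebra has a finite
normalized tight frame. -/
theorem exists_sum_inner_self_eq_one {A : Type u} [CStarAlgebra A] {E : Type w} [AddCommGroup E]
    (g : E → E → A) (hadd : ∀ x y z, g (x + y) z = g x z + g y z)
    (hsmul : ∀ (a : A) x, ∃ x', ∀ y, g x' y = a * g x y)
    (hstar : ∀ x y, star (g x y) = g y x) (hpos : ∀ x, ∃ a : A, g x x = star a * a)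
    (hfull : Dense (Submodule.span ℂ {a : A | ∃ x y, a = g x y} : Set A)) :
    ∃ (k : ℕ) (u : Fin k → E), ∑ i, g (u i) (u i) = 1 := by
  have hsub : ∀ x y, g x y + g y x ≤ g x x + g y y := by
    intro x y
    have hnn : ∀ x, 0 ≤ g x x := fun x => by
      obtain ⟨a, ha⟩ := hpos x
      exact ha ▸ star_mul_self_nonneg a
    have hl : ∀ a b c, g (a - b) c = g a c - g b c := fun a b c => by
      rw [eq_sub_iff_add_eq, ← hadd, sub_add_cancel]
    have hr : ∀ a b c, g a (b - c) = g a b - g a c := fun a b c => by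
      rw [← hstar, hl, star_sub, hstar, hstar]
    have h := hnn (x - y)
    rw [hl, hr, hr] at h
    rw [← sub_nonneg]
    convert h using 1
    abel
  -- The free factor `b` absorbs complex scalars in the induction and later becomes the inverse of a
  -- unit.
  have hspan : ∀ a ∈ Submodule.span ℂ {a : A | ∃ x y, a = g x y}, ∀ b : A,
      ∃ u : List E, b * a + star (b * a) ≤ (u.map fun x => g x x).sum := by
    intro a ha
    induction ha using Submodule.span_induction with
    | mem a h =>
      obtain ⟨x, y, rfl⟩ := h
      intro b
      obtain ⟨x', hx'⟩ := hsmul b x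
      refine ⟨[x', y], ?_⟩
      rw [← hx', hstar]
      simpa using hsub x' y
    | zero => exact fun b => ⟨[], by simp⟩
    | add a a' _ _ iha iha' =>
      intro b
      obtain ⟨u, hu⟩ := iha b
      obtain ⟨u', hu'⟩ := iha' b
      refine ⟨u ++ u', ?_⟩
      rw [List.map_append, List.sum_append, mul_add, star_add]
      convert add_le_add hu hu' using 1
      abel
    | smul c a _ iha =>
      intro b
      simpa using iha (c • b)
  -- Units form an open set, so the dense span contains one; taking `b = s⁻¹` gives `1 + 1 ≤ h`.
  -- Hence `h` is invertible, and rescaling by `h ^ (-1/2)` makes the frame tight.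
  obtain ⟨_, hs, s, rfl⟩ := hfull.exists_mem_open Units.isOpen ⟨1, isUnit_one⟩
  obtain ⟨u, hu⟩ := hspan _ hs (↑s⁻¹ : A)
  rw [Units.inv_mul, star_one] at hu
  set h : A := (u.map fun x => g x x).sum with hh
  have h0 : IsStrictlyPositive h :=
    ((isStrictlyPositive_one (A := A)).add_nonneg zero_le_one).of_le hu
  set c : A := h ^ (-(1 / 2) : ℝ) with hc
  have hcs : star c = c := (CFC.rpow_nonneg (a := h)).isSelfAdjoint
  have hch : c * h * c = 1 := CFC.conjugate_rpow_neg_one_half h h0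
  choose f hf using hsmul c
  have hff (x : E) : g (f x) (f x) = c * g x x * c := by
    rw [hf, ← hstar, hf, star_mul, hstar, hcs, mul_assoc]
  refine ⟨u.length, fun i => f u[i], ?_⟩
  simp only [hff]
  rw [← Finset.sum_mul, ← Finset.mul_sum, ← hch, hh]
  congr 2
  exact Fin.sum_univ_fun_getElem u fun x => g x x

end Frame

/-! ### Frames of an equivalence bimodule and the embeddings they define. -/

namespace EquivalenceBimodule

variable {A : Type u} {B : Type v} {E : Type w} [CStarAlgebra A]
  [CStarAlgebra B] [AddCommGroup E] [Module ℂ E] [Module A E] [Module Bᵐᵒᵖ E]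
  [IsScalarTower ℂ A E] [IsScalarTower ℂ Bᵐᵒᵖ E] [SMulCommClass A Bᵐᵒᵖ E]
  (X : EquivalenceBimodule A B E)

open MulOpposite

theorem right_add_left (x y z : E) :
    X.right.inner (x + y) z = X.right.inner x z + X.right.inner y z := by
  rw [← X.right.star_inner, X.right.inner_add_right, star_add, X.right.star_inner,
    X.right.star_inner]

theorem right_smul_left (x y : E) (b : B) :
    X.right.inner (op b • x) y = star b * X.right.inner x y := by
  rw [← X.right.star_inner, X.right.inner_smul_right, star_mul, X.right.star_inner]

theorem left_sum_left {ι : Type*} (s : Finset ι) (f : ι → E) (y : E) :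
    X.left.inner (∑ i ∈ s, f i) y = ∑ i ∈ s, X.left.inner (f i) y :=
  map_sum (AddMonoidHom.mk' (fun x => X.left.inner x y) fun x z => X.left.inner_add_left x z y) f s

theorem right_sum_right {ι : Type*} (s : Finset ι) (x : E) (f : ι → E) :
    X.right.inner x (∑ i ∈ s, f i) = ∑ i ∈ s, X.right.inner x (f i) :=
  map_sum (AddMonoidHom.mk' (fun y => X.right.inner x y) fun y z => X.right.inner_add_right x y z)
    f s

theorem exists_left_frame :
    ∃ (k : ℕ) (u : Fin k → E), ∑ i, X.left.inner (u i) (u i) = 1 :=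
  exists_sum_inner_self_eq_one X.left.inner X.left.inner_add_left
    (fun a x => ⟨a • x, X.left.inner_smul_left a x⟩) X.left.star_inner X.left.inner_self_nonneg
    X.left.full

theorem exists_right_frame :
    ∃ (k : ℕ) (v : Fin k → E), ∑ i, X.right.inner (v i) (v i) = 1 :=
  exists_sum_inner_self_eq_one X.right.inner X.right_add_left
    (fun b x => ⟨op (star b) • x, fun y => by rw [X.right_smul_left, star_star]⟩)
    X.right.star_inner X.right.inner_self_nonneg X.right.full

theorem right_inner_left_inner_smul (x y z w : E) :
    X.right.inner x (X.left.inner y z • w) = X.right.inner x y * X.right.inner z w := by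
  rw [X.left_smul_eq, X.right.inner_smul_right]

theorem left_inner_smul_right_inner (x y z w : E) :
    X.left.inner (op (X.right.inner x y) • z) w = X.left.inner z x * X.left.inner y w := by
  rw [← X.left_smul_eq, X.left.inner_smul_left]

theorem left_complex_smul (c : ℂ) (x y : E) :
    X.left.inner (c • x) y = c • X.left.inner x y := by
  rw [← one_smul A x, ← smul_assoc, X.left.inner_smul_left, one_smul, smul_one_mul]

theorem right_complex_smul (c : ℂ) (x y : E) :
    X.right.inner x (c • y) = c • X.right.inner x y := by
  rw [← one_smul Bᵐᵒᵖ y, ← smul_assoc, one_smul, ← op_one, ← op_smul, X.right.inner_smul_right,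
    mul_smul_one]

variable {X} {k : ℕ} {u v : Fin k → E}

theorem sum_smul_right_inner (hu : ∑ i, X.left.inner (u i) (u i) = 1) (z : E) :
    ∑ i, op (X.right.inner (u i) z) • u i = z := by
  simp_rw [← X.left_smul_eq]
  rw [← Finset.sum_smul, hu, one_smul]

theorem sum_left_inner_smul (hv : ∑ i, X.right.inner (v i) (v i) = 1) (z : E) :
    ∑ i, X.left.inner z (v i) • v i = z := by
  simp_rw [X.left_smul_eq]
  rw [← Finset.sum_smul, ← Finset.op_sum, hv, op_one, one_smul]

theorem sum_left_inner_smul_self (hu : ∑ i, X.left.inner (u i) (u i) = 1) (a : A) :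
    ∑ i, X.left.inner (a • u i) (u i) = a := by
  simp_rw [X.left.inner_smul_left]
  rw [← Finset.mul_sum, hu, mul_one]

theorem sum_right_inner_smul_self (hv : ∑ i, X.right.inner (v i) (v i) = 1) (b : B) :
    ∑ i, X.right.inner (v i) (op b • v i) = b := by
  simp_rw [X.right.inner_smul_right]
  rw [← Finset.sum_mul, hv, one_mul]

/-- The frame writes `a` as a sum of left inner products, and these act as rank-one operators for
the right inner product, with the evident adjoints. -/
theorem right_smul_adjoint (hu : ∑ i, X.left.inner (u i) (u i) = 1) (a : A) (x y : E) :
    X.right.inner (a • x) y = X.right.inner x (star a • y) := by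
  rw [← sum_left_inner_smul_self hu a, ← X.right.star_inner]
  simp only [star_sum, X.left.star_inner, Finset.sum_smul, right_sum_right,
    right_inner_left_inner_smul, star_mul, X.right.star_inner]

theorem left_smul_adjoint (hv : ∑ i, X.right.inner (v i) (v i) = 1) (b : B) (x y : E) :
    X.left.inner (op b • x) y = X.left.inner x (op (star b) • y) := by
  rw [← sum_right_inner_smul_self hv b, ← X.left.star_inner _ x]
  simp only [star_sum, X.right.star_inner, Finset.op_sum, Finset.sum_smul, left_sum_left,
    left_inner_smul_right_inner, star_mul, X.left.star_inner]

variable (X) in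
/-- The representation of `A` by matrices over `B` given by a frame of the left module. -/
def leftHom (hu : ∑ i, X.left.inner (u i) (u i) = 1) :
    A →⋆ₙₐ[ℂ] Matrix (Fin k) (Fin k) B where
  toFun a := Matrix.of fun i j => X.right.inner (u i) (a • u j)
  map_smul' c a := by
    ext i j
    simp [smul_assoc, right_complex_smul]
  map_zero' := by
    ext i j
    simpa using X.right_complex_smul 0 (u i) 0
  map_add' a b := by
    ext i j
    simp [add_smul, X.right.inner_add_right]
  map_mul' a b := by
    ext i j
    simp only [Matrix.mul_apply, Matrix.of_apply]
    conv_lhs => rw [mul_smul, ← sum_smul_right_inner hu (b • u j), Finset.smul_sum]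
    simp only [smul_comm a, right_sum_right, X.right.inner_smul_right]
  map_star' a := by
    ext i j
    simp only [Matrix.star_apply, Matrix.of_apply, X.right.star_inner, right_smul_adjoint hu]

theorem leftHom_apply (hu : ∑ i, X.left.inner (u i) (u i) = 1) (a : A) (i j : Fin k) :
    X.leftHom hu a i j = X.right.inner (u i) (a • u j) := rfl

theorem isCornerEmbedding_leftHom (hu : ∑ i, X.left.inner (u i) (u i) = 1) :
    IsCornerEmbedding (X.leftHom hu) where
  injective := by
    rw [injective_iff_map_eq_zero]
    intro a ha
    have h (j) : a • u j = 0 := by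
      rw [← sum_smul_right_inner hu (a • u j)]
      exact Finset.sum_eq_zero fun i _ => by
        rw [← leftHom_apply hu, ha, Matrix.zero_apply, op_zero, zero_smul]
    rw [← sum_left_inner_smul_self hu a]
    exact Finset.sum_eq_zero fun i _ => by
      rw [h, ← zero_smul A (0 : E), X.left.inner_smul_left, zero_mul]
  exists_eq y := by
    -- The operator with matrix `y` in the frame, as a sum of rank-one operators.
    refine ⟨∑ j, ∑ i, X.left.inner (op (y i j) • u i) (u j), ?_⟩
    ext l m
    simp only [leftHom_apply, Matrix.mul_apply, one_smul, Finset.sum_smul, right_sum_right,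
      right_inner_left_inner_smul, X.right.inner_smul_right, Finset.sum_mul]

variable (X) in
/-- The representation of `B` by matrices over `A` given by a frame of the right module. -/
def rightHom (hv : ∑ i, X.right.inner (v i) (v i) = 1) :
    B →⋆ₙₐ[ℂ] Matrix (Fin k) (Fin k) A where
  toFun b := Matrix.of fun i j => X.left.inner (op b • v i) (v j)
  map_smul' c a := by
    ext i j
    simp [smul_assoc, left_complex_smul]
  map_zero' := by
    ext i j
    simpa using X.left_complex_smul 0 0 (v j)
  map_add' a b := by
    ext i j
    simp [add_smul, X.left.inner_add_left]
  map_mul' a b := by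
    ext i j
    simp only [Matrix.mul_apply, Matrix.of_apply]
    conv_lhs => rw [op_mul, mul_smul, ← sum_left_inner_smul hv (op a • v i), Finset.smul_sum]
    simp only [← smul_comm _ (op b), left_sum_left, X.left.inner_smul_left]
  map_star' a := by
    ext i j
    simp only [Matrix.star_apply, Matrix.of_apply, X.left.star_inner, left_smul_adjoint hv,
      star_star]

theorem rightHom_apply (hv : ∑ i, X.right.inner (v i) (v i) = 1) (b : B) (i j : Fin k) :
    X.rightHom hv b i j = X.left.inner (op b • v i) (v j) := rfl

theorem isCornerEmbedding_rightHom (hv : ∑ i, X.right.inner (v i) (v i) = 1) :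
    IsCornerEmbedding (X.rightHom hv) where
  injective := by
    rw [injective_iff_map_eq_zero]
    intro b hb
    have h (i) : op b • v i = 0 := by
      rw [← sum_left_inner_smul hv (op b • v i)]
      exact Finset.sum_eq_zero fun j _ => by
        rw [← rightHom_apply hv, hb, Matrix.zero_apply, zero_smul]
    rw [← sum_right_inner_smul_self hv b]
    exact Finset.sum_eq_zero fun i _ => by
      rw [h, ← smul_zero (op (0 : B)), X.right.inner_smul_right, mul_zero]
  exists_eq y := by
    refine ⟨∑ j, ∑ i, X.right.inner (v i) (y i j • v j), ?_⟩
    ext l m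
    simp only [rightHom_apply, Matrix.mul_apply, op_one, one_smul, Finset.op_sum, Finset.sum_smul,
      left_sum_left, left_inner_smul_right_inner, X.left.inner_smul_left, Finset.sum_mul, mul_assoc]

theorem trace_leftHom_mul_trace_rightHom (hA : HasUniqueTrace A) (hB : HasUniqueTrace B) {l : ℕ}
    {v : Fin l → E} (hu : ∑ i, X.left.inner (u i) (u i) = 1)
    (hv : ∑ i, X.right.inner (v i) (v i) = 1) :
    hB.trace (X.leftHom hu 1).trace * hA.trace (X.rightHom hv 1).trace = 1 := by
  -- By the frame expansion of `x`, the two sides are the traces of `∑ ⟨uᵢ, x⟩⟨x, uᵢ⟩` and `∑ ⟨x,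
  -- uᵢ⟩⟨uᵢ, x⟩`. Summing over `x = vⱼ` then gives `τ_B(1) = 1`.
  have key (x : E) :
      hB.trace (X.leftHom hu (X.left.inner x x)).trace = hB.trace (X.right.inner x x) := by
    conv_rhs => enter [2, 3]; rw [← sum_smul_right_inner hu x]
    simp only [Matrix.trace, Matrix.diag_apply, leftHom_apply, right_inner_left_inner_smul,
      right_sum_right, X.right.inner_smul_right, map_sum]
    exact Finset.sum_congr rfl fun i _ => hB.isNormalizedTrace_trace.map_mul_comm _ _
  have h1 : (X.rightHom hv 1).trace = ∑ i, X.left.inner (v i) (v i) := by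
    simp [Matrix.trace, rightHom_apply]
  rw [← hA.map_trace_starAlgHom hB, h1, ← hB.isNormalizedTrace_trace.map_one, ← hv]
  simp only [map_sum, Matrix.trace_sum, key]

end EquivalenceBimodule

theorem mainTheorem2 (A : Type u) (B : Type v) [CStarAlgebra A] [CStarAlgebra B]
    (hA : IsSimpleCStarAlgebra A) (hB : IsSimpleCStarAlgebra B)
    (hτA : HasUniqueTrace A) (hτB : HasUniqueTrace B)
    (hAB : MoritaEquivalent.{u, v, w} A B) :
    fundamentalGroup A hτA = fundamentalGroup B hτB := by
  obtain ⟨E, _, _, _, _, _, _, _, ⟨X⟩⟩ := hAB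
  obtain ⟨k, u, hu⟩ := X.exists_left_frame
  obtain ⟨l, v, hv⟩ := X.exists_right_frame
  have h := X.trace_leftHom_mul_trace_rightHom hτA hτB hu hv
  have hθ := X.isCornerEmbedding_leftHom hu
  have hρ := X.isCornerEmbedding_rightHom hv
  exact (fundamentalGroup_subset hτA hτB hθ hρ h).antisymm
    (fundamentalGroup_subset hτB hτA hρ hθ (by rwa [mul_comm]))
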